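/- **Conventions.** Finite subsets of $\mathbb N$ are identified with finite strictly increasing sequences. $E<F$ means that every element of $E$ is smaller than every element of $F$ (so $\varnothing<E<\varnothing$ for every $E$). $E\preceq F$ means that $E$ is an initial segment of $F$, and $E\prec F$ that it is a proper one; $E|_k$ is the initial segment of $E$ of length $k$. A family $\mathcal F$ of finite subsets of $\mathbb N$ is *regular* if it is compact in the Cantor set $\{0,1\}^{\mathbb N}$, contains all subsets of its members, and contains all spreads of its members ($(l_i)_{i=1}^n$ is a spread of $(k_i)_{i=1}^n$ if $k_i\le l_i$ for all $i$). $MAX(\mathcal F)$ is the set of $\prec$-maximal members of $\mathcal F$, and $\widehat{\mathcal F}=\mathcal F\setminus\{\varnothing\}$. Put $\mathcal F^0=\mathcal F$, $\mathcal F^{\xi+1}=\mathcal F^\xi\setminus MAX(\mathcal F^\xi)$, $\mathcal F^\xi=\bigcap_{\zeta<\xi}\mathcal F^\zeta$ for limit $\xi$, and $\iota(\mathcal F)=\min\{\xi<\omega_1:\mathcal F^\xi\subset\{\varnothing\}\}$. The Hessenberg (natural) sum of ordinals, which adds the coefficients of the Cantor normal forms, is denoted by $\oplus$. *Fine Schreier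 families* $(\mathcal F_\xi)_{\xi<\omega_1}$ are defined by $\mathcal F_0=\{\varnothing\}$, $\mathcal F_{\xi+1}=\{E\cup G: |E|\le 1,\ G\in\mathcal F_\xi,\ E<G\}$, and, for limit $\xi$, $\mathcal F_\xi=\{E:\exists n\in\mathbb N,\ n\le \min E \text{ (no condition if } E=\varnothing)\text{ and } E\in\mathcal F_{\eta_n+m_n}\}$, where $\eta_n\uparrow\xi$ (non-decreasing, $\eta_n<\xi$, with supremum $\xi$) and $m_n\in\mathbb N\cup\{0\}$ are chosen such that $\mathcal F_{\eta_n+m_n}\subset\mathcal F_{\eta_{n+1}+m_{n+1}}$ for all $n$. The choices are fixed arbitrarily. A *coloring* of $\mathcal F$ is a collection $(\mathcal A^0_E,\mathcal A^1_E)_{E\in\widehat{\mathcal F}}$ of subsets of $MAX(\mathcal F)$ such that $\mathcal A^0_E\cup\mathcal A^1_E=\{F\in MAX(\mathcal F):E\preceq F\}$ for every $E\in\widehat{\mathcal F}$. An *extended embedding* of $\mathcal G$ into $\mathcal F$ is a pair $(i,e)$ consisting of an injective map $i:\widehat{\mathcal G}\to\widehat{\mathcal F}$ with $E\prec F\iff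 i(E)\prec i(F)$ and a map $e:MAX(\mathcal G)\to MAX(\mathcal F)$ with $i(E)\preceq e(E)$ for all non-empty $E\in MAX(\mathcal G)$. The coloring of $\mathcal G$ *induced* by $(i,e)$ is $\mathcal B^j_E=\{F\in MAX(\mathcal G):e(F)\in\mathcal A^j_{i(E)}\}$; it is *monochromatically* $j$ if $F\in\mathcal B^j_{F|_k}$, that is, $e(F)\in\mathcal A^j_{i(F|_k)}$, for all $F\in MAX(\mathcal G)$ and $1\le k\le|F|$. **Lemma (Coloring lemma for sums).** Let $\mathcal F$ be a regular family with $\iota(\mathcal F)>0$ and let $(\mathcal A^0_E,\mathcal A^1_E)_{E\in\widehat{\mathcal F}}$ be a coloring of $\mathcal F$. Then there are ordinals $\xi_0,\xi_1<\omega_1$ with $\xi_0\oplus\xi_1=\iota(\mathcal F)$ and, for $j=0,1$, an extended embedding $(i_j,e_j)$ of $\mathcal F_{\xi_j}$ into $\mathcal F$ such that the coloring of $\mathcal F_{\xi_j}$ induced by $(i_j,e_j)$ is monochromatically $j$. -/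

import Mathlib

open scoped Ordinal

namespace RegularFamily

/-! Finite subsets of `ℕ` are identified with strictly increasing finite sequences.  Only the order
of the set of natural numbers plays a role, so `ℕ` starts at `0` here. -/

/-- `E < F`: every element of `E` is smaller than every element of `F`
(with `∅ < F` and `E < ∅` by convention). -/
def Below (E F : Finset ℕ) : Prop := ∀ a ∈ E, ∀ b ∈ F, a < b

/-- `E ⪯ F`: as a sequence, `E` is a (not necessarily proper) initial segment of `F`. -/
def Init (E F : Finset ℕ) : Prop := E ⊆ F ∧ Below E (F \ E)

/-- `E ≺ F`: `E` is a proper initial segment of `F`. -/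
def PInit (E F : Finset ℕ) : Prop := Init E F ∧ E ≠ F

/-- `(l_i)` is a spread of `(k_i)`: same length and `k_i ≤ l_i` for every `i`. -/
def IsSpread (L K : Finset ℕ) : Prop :=
  ∃ (n : ℕ) (k l : Fin n → ℕ), StrictMono k ∧ StrictMono l ∧ (∀ i, k i ≤ l i) ∧
    K = Finset.univ.image k ∧ L = Finset.univ.image l

/-- The family contains all subsets of its members. -/
def IsHereditary (F : Set (Finset ℕ)) : Prop := ∀ E ∈ F, ∀ G, G ⊆ E → G ∈ F

/-- The family contains all spreads of its members. -/
def IsSpreading (F : Set (Finset ℕ)) : Prop := ∀ E ∈ F, ∀ G, IsSpread G E → G ∈ F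

/-- The point of the Cantor set `{0,1}^ℕ` which corresponds to `E`. -/
def toCantor (E : Finset ℕ) : ℕ → Bool := fun n => decide (n ∈ E)

/-- A regular family: compact (in the Cantor set), spreading and hereditary. -/
structure IsRegular (F : Set (Finset ℕ)) : Prop where
  compact : IsCompact (toCantor '' F)
  spreading : IsSpreading F
  hereditary : IsHereditary F

/-- The maximal elements of `F` with respect to `≺`. -/
def MAX (F : Set (Finset ℕ)) : Set (Finset ℕ) := {E | E ∈ F ∧ ∀ G ∈ F, ¬ PInit E G}

/-- `F` without the empty set. -/
def hat (F : Set (Finset ℕ)) : Set (Finset ℕ) := F \ {∅}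

/-- The transfinite derivatives of `F`: maximal elements are removed at successor steps,
intersections are taken at limit steps. -/
noncomputable def deriv (F : Set (Finset ℕ)) (ξ : Ordinal.{0}) : Set (Finset ℕ) :=
  Ordinal.limitRecOn ξ F (fun _ T => T \ MAX T) (fun ξ _ T => ⋂ (ζ) (h : ζ < ξ), T ζ h)

/-- `ι(F)`, the least countable ordinal `ξ` such that the `ξ`-th derivative of `F` is contained
in `{∅}`. -/
noncomputable def iota (F : Set (Finset ℕ)) : Ordinal.{0} :=
  sInf {ξ | ξ < ω₁ ∧ deriv F ξ ⊆ {∅}}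

/-- `(F, G)`: all unions `E ∪ H` with `E ∈ F`, `H ∈ G` and `E < H`. -/
def sumFamily (F G : Set (Finset ℕ)) : Set (Finset ℕ) :=
  {K | ∃ E ∈ F, ∃ H ∈ G, Below E H ∧ K = E ∪ H}

/-- `𝒜₁`: the sets with at most one element. -/
def atMostOne : Set (Finset ℕ) := {E | E.card ≤ 1}

/-- The diagonalization `𝒟(G_n) = {E : ∃ n ≤ E, E ∈ G_n}`. -/
def diag (G : ℕ → Set (Finset ℕ)) : Set (Finset ℕ) := {E | ∃ n, (∀ x ∈ E, n ≤ x) ∧ E ∈ G n}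

/-- `𝓢 ξ` is obtained from smaller indices as in the limit step of the definition of the fine
Schreier families: for some `η n ↑ ξ` and some integers `m n` the families `𝓢 (η n + m n)` increase
with `n`, and `𝓢 ξ` is their diagonalization. -/
def IsLimitStep (𝓢 : Ordinal.{0} → Set (Finset ℕ)) (ξ : Ordinal.{0}) : Prop :=
  ∃ (η : ℕ → Ordinal.{0}) (m : ℕ → ℕ),
    Monotone η ∧ (∀ n, η n < ξ) ∧ IsLUB (Set.range η) ξ ∧
    (∀ n, 𝓢 (η n + m n) ⊆ 𝓢 (η (n + 1) + m (n + 1))) ∧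
    𝓢 ξ = diag fun n => 𝓢 (η n + m n)

/-- `𝓢 ξ`, `ξ < ω₁`, are fine Schreier families.  Their recursive definition involves a choice
at every limit ordinal; the predicate allows every such choice.
The values `𝓢 ξ` for `ξ ≥ ω₁` are irrelevant. -/
structure IsFineSchreier (𝓢 : Ordinal.{0} → Set (Finset ℕ)) : Prop where
  zero : 𝓢 0 = {∅}
  succ : ∀ ξ < ω₁, 𝓢 (ξ + 1) = sumFamily atMostOne (𝓢 ξ)
  limit : ∀ ξ < ω₁, Order.IsSuccLimit ξ → IsLimitStep 𝓢 ξ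

/-- The Hessenberg (natural) sum: the coefficients of the Cantor normal forms are added. -/
noncomputable def hessenberg (ξ ζ : Ordinal.{0}) : Ordinal.{0} :=
  Ordinal.CNF.eval ω (Ordinal.CNF.coeff ω ξ + Ordinal.CNF.coeff ω ζ)

/-- `(A 0 E, A 1 E)`, for `E ∈ F` non-empty, is a coloring of `F`: each maximal element of `F`
gives each of its non-empty initial segments at least one of the colors `0`, `1`. -/
def IsColoring (F : Set (Finset ℕ)) (A : Fin 2 → Finset ℕ → Set (Finset ℕ)) : Prop :=
  ∀ E ∈ hat F, A 0 E ∪ A 1 E = {H | H ∈ MAX F ∧ Init E H}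

/-- `(i, e)` is an extended embedding of `F` into `G`: `i` maps the non-empty members of `F` to
non-empty members of `G`, injectively and so that `E ≺ H` if and only if `i E ≺ i H`;
`e` maps `MAX F` to `MAX G`; and `i E ⪯ e E` for `E ∈ MAX F` (if `E = ∅`, then `i E` is not
defined and there is no such condition).  The values of `i` and `e` elsewhere are irrelevant. -/
structure IsExtendedEmbedding (F G : Set (Finset ℕ)) (i e : Finset ℕ → Finset ℕ) : Prop where
  mapsTo_i : Set.MapsTo i (hat F) (hat G)
  injOn_i : Set.InjOn i (hat F)
  pInit_iff : ∀ E ∈ hat F, ∀ H ∈ hat F, PInit E H ↔ PInit (i E) (i H)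
  mapsTo_e : Set.MapsTo e (MAX F) (MAX G)
  init_i_e : ∀ E ∈ MAX F, E ≠ ∅ → Init (i E) (e E)

/-- The coloring `B^j_E = {H ∈ MAX F : e H ∈ A^j_{i E}}` of `F` which is induced by `(i, e)` and
the coloring `A`. -/
def inducedColoring (F : Set (Finset ℕ)) (A : Fin 2 → Finset ℕ → Set (Finset ℕ))
    (i e : Finset ℕ → Finset ℕ) : Fin 2 → Finset ℕ → Set (Finset ℕ) :=
  fun j E => {H | H ∈ MAX F ∧ e H ∈ A j (i E)}

/-- The coloring `B` of `F` is monochromatically `j`: each maximal element of `F` gives each of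
its non-empty initial segments the color `j`. -/
def IsMonochromatic (F : Set (Finset ℕ)) (B : Fin 2 → Finset ℕ → Set (Finset ℕ))
    (j : Fin 2) : Prop :=
  ∀ H ∈ MAX F, ∀ E, E ≠ ∅ → Init E H → H ∈ B j E

/-! The choices in the definition of the fine Schreier families are possible. -/

open Classical in
/-- One system of fine Schreier families, for some choice at each limit ordinal. -/
noncomputable def fs (ξ : Ordinal.{0}) : Set (Finset ℕ) :=
  Ordinal.limitRecOn ξ {∅} (fun _ S => sumFamily atMostOne S)
   (fun ξ _ S => if h : ∃ s : ℕ → Set.Iio ξ, (∃ (η : ℕ → Ordinal.{0}) (m : ℕ → ℕ), Monotone η ∧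
      (∀ n, η n < ξ) ∧ IsLUB (Set.range η) ξ ∧ ∀ n, (s n : Ordinal) = η n + m n) ∧
      ∀ n, S (s n).1 (s n).2 ⊆ S (s (n+1)).1 (s (n+1)).2
    then diag (fun n => S (h.choose n).1 (h.choose n).2) else ∅)

section
variable {S : Ordinal.{0} → Set (Finset ℕ)} {ξ : Ordinal.{0}}

lemma fs_subset_succ (h0 : ∀ ζ, S (ζ + 1) = sumFamily atMostOne (S ζ)) (ζ) : S ζ ⊆ S (ζ + 1) := by
  intro E hE
  rw [h0]
  exact ⟨∅, by simp [atMostOne], E, hE, by simp [Below], by simp⟩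

lemma fs_hereditary (z : S 0 = {∅}) (h0 : ∀ ζ, S (ζ + 1) = sumFamily atMostOne (S ζ))
    (hl : ∀ ζ < ξ, Order.IsSuccLimit ζ → IsLimitStep S ζ) :
    ∀ ζ < ξ, IsHereditary (S ζ) := by
  intro ζ
  induction ζ using Ordinal.limitRecOn with
  | zero => intro _ E hE G hG; rw [z] at *; simp_all
  | add_one ζ ih =>
    intro h E hE G hG
    have hE : E ∈ sumFamily atMostOne (S ζ) := h0 ζ ▸ hE
    rw [h0 ζ]
    obtain ⟨A, hA, B, hB, hAB, rfl⟩ := id hE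
    refine ⟨A ∩ G, ?_, B ∩ G, ih (lt_trans (by simp) h) _ hB _ Finset.inter_subset_left, ?_, ?_⟩
    · exact (Finset.card_le_card Finset.inter_subset_left).trans hA
    · intro a ha b hb; exact hAB a (by simp_all) b (by simp_all)
    · rw [← Finset.union_inter_distrib_right]; exact (Finset.inter_eq_right.2 hG).symm
  | limit ζ hζ ih =>
    intro h E hE G hG
    obtain ⟨η, m, h1, h2, h3, h4, h5⟩ := hl ζ h hζ
    rw [h5]
    have hE2 : E ∈ diag fun n => S (η n + m n) := h5 ▸ hE
    obtain ⟨n, hn, hE⟩ := hE2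
    refine ⟨n, fun x hx => hn x (hG hx), ih _ ?_ (lt_trans ?_ h) _ hE _ hG⟩ <;>
    exact hζ.add_natCast_lt (h2 n) _

lemma fs_tail (h0 : ∀ ζ, S (ζ + 1) = sumFamily atMostOne (S ζ))
    (hl : ∀ ζ < ξ, Order.IsSuccLimit ζ → IsLimitStep S ζ) (ζ) :
    ∀ η < ξ, ζ ≤ η → ∃ m, ∀ E ∈ S ζ, (∀ x ∈ E, m ≤ x) → E ∈ S η := by
  intro η
  induction η using Ordinal.limitRecOn with
  | zero => intro _ h; obtain rfl : ζ = 0 := by simpa using h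
            exact ⟨0, fun E h _ => h⟩
  | add_one η ih =>
    intro h hle
    rcases hle.eq_or_lt with rfl | hlt
    · exact ⟨0, fun E h _ => h⟩
    · obtain ⟨m, hm⟩ := ih (lt_trans (by simp) h) (Order.lt_add_one_iff.1 hlt)
      exact ⟨m, fun E h h' => fs_subset_succ h0 _ (hm E h h')⟩
  | limit η hη ih =>
    intro h hle
    rcases hle.eq_or_lt with rfl | hlt
    · exact ⟨0, fun E h _ => h⟩
    · obtain ⟨e, m, h1, h2, h3, h4, h5⟩ := hl η h hη
      obtain ⟨_, ⟨n, rfl⟩, hn⟩ := (lt_isLUB_iff h3).1 hlt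
      have hlt' := hη.add_natCast_lt (h2 n) (m n)
      obtain ⟨k, hk⟩ := ih _ hlt' (hlt'.trans h) (hn.le.trans (by simp))
      refine ⟨max k n, fun E hE hx => ?_⟩
      rw [h5]
      exact ⟨n, fun x h => (le_max_right k n).trans (hx x h),
        hk E hE fun x h => (le_max_left k n).trans (hx x h)⟩

lemma fs_add_nat (h0 : ∀ ζ, S (ζ + 1) = sumFamily atMostOne (S ζ)) (η : Ordinal.{0}) :
    ∀ (n : ℕ) (A B : Finset ℕ), A.card ≤ n → B ∈ S η → Below A B → A ∪ B ∈ S (η + n) := by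
  intro n
  induction n with
  | zero => intro A B hA hB h; simp_all
  | succ n ih =>
    intro A B hA hB h
    have : η + ((n+1 : ℕ) : Ordinal) = (η + n) + 1 := by push_cast; rw [add_assoc]
    rw [this]
    rcases A.eq_empty_or_nonempty with rfl | hne
    · exact fs_subset_succ h0 _ (ih ∅ B (by simp) hB h)
    · rw [h0]
      refine ⟨{A.min' hne}, by simp [atMostOne], A.erase (A.min' hne) ∪ B, ih _ _ ?_ hB ?_, ?_, ?_⟩
      · rw [Finset.card_erase_of_mem (A.min'_mem hne)]; omega
      · intro a ha b hb; exact h a (Finset.mem_of_mem_erase ha) b hb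
      · intro a ha b hb
        obtain rfl := Finset.mem_singleton.1 ha
        rcases Finset.mem_union.1 hb with hb | hb
        · exact Finset.min'_lt_of_mem_erase_min' _ _ hb
        · exact h _ (A.min'_mem hne) b hb
      · rw [← Finset.union_assoc, ← Finset.insert_eq, Finset.insert_erase (A.min'_mem hne)]

lemma fs_bump (z : S 0 = {∅}) (h0 : ∀ ζ, S (ζ + 1) = sumFamily atMostOne (S ζ))
    (hl : ∀ ζ < ξ, Order.IsSuccLimit ζ → IsLimitStep S ζ) (ζ η) (hη : η < ξ) (h : ζ ≤ η) :
    ∃ n : ℕ, S ζ ⊆ S (η + n) := by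
  obtain ⟨m, hm⟩ := fs_tail h0 hl ζ η hη h
  refine ⟨m, fun E hE => ?_⟩
  have := fs_add_nat h0 η m (E.filter (· < m)) (E.filter (¬ · < m)) ?_ (hm _
    (fs_hereditary z h0 hl ζ (h.trans_lt hη) E hE _ (Finset.filter_subset _ _)) ?_) ?_
  · rwa [Finset.filter_union_filter_not_eq] at this
  · calc _ ≤ (Finset.range m).card := Finset.card_le_card (by intro x; simp)
      _ = m := by simp
  · intro x; simp
  · intro a ha b hb; simp at *; omega

lemma exists_seq_of_limit (hξ : ξ < ω₁) (hlim : Order.IsSuccLimit ξ) : ∃ η : ℕ → Ordinal.{0},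
    Monotone η ∧ (∀ n, η n < ξ) ∧ IsLUB (Set.range η) ξ := by
  have hc : (Set.Iio ξ).Countable := by
    rw [← Cardinal.le_aleph0_iff_set_countable, Cardinal.mk_Iio_ordinal]
    simp only [Cardinal.lift_le_aleph0]
    rwa [Cardinal.card_le_iff, Cardinal.succ_aleph0, Cardinal.ord_aleph]
  obtain ⟨f, hf⟩ := hc.exists_eq_range ⟨0, hlim.bot_lt⟩
  have hlt : ∀ n, f n < ξ := fun n => by
    have : f n ∈ Set.Iio ξ := hf ▸ ⟨n, rfl⟩
    exact this
  refine ⟨partialSups f, (partialSups f).monotone, fun n => ?_, ?_, ?_⟩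
  · induction n with
    | zero => simpa using hlt 0
    | succ n ih => rw [partialSups_add_one]; exact max_lt ih (hlt _)
  · rintro _ ⟨n, rfl⟩
    refine le_of_lt ?_
    induction n with
    | zero => simpa using hlt 0
    | succ n ih => rw [partialSups_add_one]; exact max_lt ih (hlt _)
  · intro b hb
    by_contra! hlt
    have h1 : b + 1 < ξ := hlim.add_one_lt hlt
    have : b + 1 ∈ Set.range f := hf ▸ h1
    obtain ⟨n, hn⟩ := this
    have h2 : f n ≤ b := (le_partialSups f n).trans (hb ⟨n, rfl⟩)
    rw [hn] at h2
    exact absurd h2 (by simp)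
end

lemma fs_lim (ξ : Ordinal.{0}) : ξ < ω₁ → Order.IsSuccLimit ξ → IsLimitStep fs ξ := by
  induction ξ using WellFoundedLT.induction with
  | ind ξ ih =>
  intro hξ hlim
  have z : fs 0 = {∅} := by simp [fs]
  have h0 : ∀ ζ, fs (ζ + 1) = sumFamily atMostOne (fs ζ) := fun ζ => by simp [fs]
  obtain ⟨η, h1, h2, h3⟩ := exists_seq_of_limit hξ hlim
  have hb := fs_bump z h0 (fun ζ h => ih ζ h (h.trans hξ))
  have step : ∀ n (k : ℕ), ∃ l : ℕ, fs (η n + k) ⊆ fs (η (n+1) + l) := fun n k => by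
    have a : η n + k < ξ := hlim.add_natCast_lt (h2 n) k
    obtain ⟨l, hl⟩ := hb (η n + k) (η (n+1) + k) (hlim.add_natCast_lt (h2 _) k)
      (by gcongr; exact h1 (Nat.le_succ n))
    exact ⟨k + l, by push_cast; rwa [← add_assoc]⟩
  choose g hg using step
  obtain ⟨m, hm⟩ : ∃ m : ℕ → ℕ, ∀ n, m (n + 1) = g n (m n) :=
    ⟨fun n => Nat.rec 0 (fun n k => g n k) n, fun _ => rfl⟩
  have hex : ∃ s : ℕ → Set.Iio ξ, (∃ (η : ℕ → Ordinal.{0}) (m : ℕ → ℕ), Monotone η ∧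
      (∀ n, η n < ξ) ∧ IsLUB (Set.range η) ξ ∧ ∀ n, (s n : Ordinal) = η n + m n) ∧
      ∀ n, fs (s n).1 ⊆ fs (s (n+1)).1 :=
    ⟨fun n => ⟨η n + (m n : ℕ), hlim.add_natCast_lt (h2 n) (m n)⟩, ⟨η, m, h1, h2, h3, fun _ => rfl⟩,
      fun n => by have := hg n (m n); rw [← hm] at this; exact this⟩
  have key : fs ξ = diag fun n => fs (hex.choose n).1 := by
    conv_lhs => rw [fs, Ordinal.limitRecOn_limit _ _ _ _ hlim]
    exact dif_pos hex
  obtain ⟨⟨η', m', a, b, c, d⟩, e⟩ := hex.choose_spec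
  refine ⟨η', m', a, b, c, ?_, ?_⟩
  · intro n; rw [← d, ← d]; exact e n
  · rw [key]; congr 1; ext1 n; rw [d]

/-- Fine Schreier families exist: the choices in their definition can be made. -/
theorem exists_isFineSchreier : ∃ S, IsFineSchreier S :=
  ⟨fs, by simp [fs], fun ξ _ => by simp [fs], fs_lim⟩

end RegularFamily

namespace RegularFamily

/-! ### The natural sum -/

section NaturalSum
open Ordinal

/-! Everything is measured by the ranks of infinitely branching trees of nodes whose branches end in
`MAX F`. In `MonoTree C L E α` the set `L` of admissible end points is cut down to `L ∩ C c`
whenever a node `c` is chosen, so each end point that survives has the color `C` at every node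
passed on the way. By compactness and spreading, `F` itself carries an uncolored tree of rank `iota
F` over `∅` (`IsRegular.monoTree_iota`).

The heart is `MonoTree.exists_le_hessenberg`. Let `x` and `y` be the largest ranks over `E` of trees
in color 0 and color 1. If `x ⊕ y` were below the uncolored rank, there would be a node `c` of
uncolored rank `x ⊕ y` over a successor of `E` that carries no color-0 node of rank `x` and no
color-1 node of rank `y`. One color at `c` keeps enough end points to preserve the whole rank
(`MonoTree.or_of_subset_union`). Suppose it is 0. By induction, the tree at `c` yields `x'` and `y'`
with `x ⊕ y ≤ x' ⊕ y'`. But `x' < x`, as `c` itself is a node in color 0, and `y' ≤ y`, as nodes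
above `c` also lie over that successor of `E`. This contradicts strict monotonicity of the natural
sum.

The resulting `x` and `y` are lowered until their natural sum is exactly `iota F`
(`exists_hessenberg_eq`). A fine Schreier family of index `ξ` is a tree of rank at most `ξ`
(`IsFineSchreier.hereditary_and_exists_rank`), so it embeds node by node into a monochromatic tree
of rank `ξ` (`exists_isExtendedEmbedding`). -/

lemma CNF_coeff_lt_omega0 (x e : Ordinal.{0}) : CNF.coeff ω x e < ω := by
  by_cases h : e ∈ (CNF ω x).map Prod.fst
  · obtain ⟨⟨e, c⟩, hc, rfl⟩ := List.mem_map.1 h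
    rw [CNF.coeff_of_mem_CNF hc]
    exact CNF.snd_lt one_lt_omega0 hc
  · rw [CNF.coeff_of_notMem_CNF h]
    exact omega0_pos

lemma CNF_eval_filter_le (f : Ordinal.{0} →₀ Ordinal.{0}) (e : Ordinal.{0}) :
    CNF.eval ω f = CNF.eval ω (f.filter (e < ·)) +
      (ω ^ e * f e + CNF.eval ω (f.filter (· < e))) := by
  have h1 : f = f.filter (e < ·) + (Finsupp.single e (f e) + f.filter (· < e)) := by
    ext a
    rcases lt_trichotomy a e with h | rfl | h
    · simp [h, h.not_gt, h.ne']
    · simp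
    · simp [h, h.not_gt, h.ne]
  conv_lhs => rw [h1]
  rw [CNF.eval_add, CNF.eval_single_add']
  · simp
  · intro a ha b hb
    have ha : e < a := by
      rw [Finsupp.support_filter] at ha
      exact (Finset.mem_filter.1 ha).2
    refine le_trans ?_ ha.le
    by_contra! hlt
    rw [Finsupp.mem_support_iff] at hb
    simp [hlt.not_gt, hlt.ne] at hb

lemma CNF_eval_lt_of_lex {f g : Ordinal.{0} →₀ Ordinal.{0}} (hf : ∀ e, f e < ω)
    {e : Ordinal.{0}} (he : f e < g e) (h : ∀ a, e < a → f a = g a) :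
    CNF.eval ω f < CNF.eval ω g := by
  rw [CNF_eval_filter_le f e, CNF_eval_filter_le g e]
  have h1 : f.filter (e < ·) = g.filter (e < ·) := by
    ext a
    by_cases ha : e < a
    · simp [ha, h a ha]
    · simp [ha]
  rw [h1]
  gcongr
  have h2 : CNF.eval ω (f.filter (· < e)) < ω ^ e := by
    apply CNF.eval_lt
    · intro a
      rw [Finsupp.filter_apply]
      split_ifs
      · exact hf a
      · exact omega0_pos
    · simp
  calc _ < ω ^ e * f e + ω ^ e := by gcongr
    _ = ω ^ e * (f e + 1) := by rw [mul_add, mul_one]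
    _ ≤ ω ^ e * g e := by gcongr; exact Order.add_one_le_of_lt he
    _ ≤ _ := le_self_add

lemma CNF_eval_lt_iff {f g : Ordinal.{0} →₀ Ordinal.{0}} (hf : ∀ e, f e < ω)
    (hg : ∀ e, g e < ω) :
    CNF.eval ω f < CNF.eval ω g ↔ ∃ e, f e < g e ∧ ∀ a, e < a → f a = g a := by
  refine ⟨fun h => ?_, fun ⟨e, he, h⟩ => CNF_eval_lt_of_lex hf he h⟩
  have hne : (f.neLocus g).Nonempty := by
    rw [Finsupp.nonempty_neLocus_iff]
    rintro rfl
    exact h.false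
  have hmem := (f.neLocus g).max'_mem hne
  have hmax : ∀ a, (f.neLocus g).max' hne < a → f a = g a := by
    intro a ha
    by_contra hc
    exact ha.not_ge (Finset.le_max' _ _ (Finsupp.mem_neLocus.2 hc))
  refine ⟨_, (Finsupp.mem_neLocus.1 hmem).lt_of_le ?_, hmax⟩
  by_contra! hlt
  exact (CNF_eval_lt_of_lex hg hlt fun a ha => (hmax a ha).symm).asymm h

lemma CNF_eval_mono {f g : Ordinal.{0} →₀ Ordinal.{0}} (hf : ∀ e, f e < ω)
    (hg : ∀ e, g e < ω) (h : ∀ e, f e ≤ g e) : CNF.eval ω f ≤ CNF.eval ω g := by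
  by_contra! hlt
  obtain ⟨e, he, -⟩ := (CNF_eval_lt_iff hg hf).1 hlt
  exact he.not_ge (h e)

lemma lt_iff_CNF_coeff {x y : Ordinal.{0}} : x < y ↔ ∃ e, CNF.coeff ω x e < CNF.coeff ω y e ∧
    ∀ a, e < a → CNF.coeff ω x a = CNF.coeff ω y a := by
  rw [← CNF_eval_lt_iff (CNF_coeff_lt_omega0 x) (CNF_coeff_lt_omega0 y), CNF.eval_coeff,
    CNF.eval_coeff]

lemma CNF_coeff_add_lt_omega0 (x y e : Ordinal.{0}) :
    (CNF.coeff ω x + CNF.coeff ω y) e < ω :=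
  isPrincipal_add_omega0 (CNF_coeff_lt_omega0 x e) (CNF_coeff_lt_omega0 y e)

lemma hessenberg_comm (x y : Ordinal.{0}) : hessenberg x y = hessenberg y x := by
  unfold hessenberg
  congr 1
  ext e
  obtain ⟨m, hm⟩ := lt_omega0.1 (CNF_coeff_lt_omega0 x e)
  obtain ⟨n, hn⟩ := lt_omega0.1 (CNF_coeff_lt_omega0 y e)
  simp only [Finsupp.add_apply, hm, hn]
  exact_mod_cast add_comm m n

lemma hessenberg_zero_right (x : Ordinal.{0}) : hessenberg x 0 = x := by
  simp [hessenberg]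

lemma hessenberg_zero_left (x : Ordinal.{0}) : hessenberg 0 x = x := by
  simp [hessenberg]

lemma hessenberg_strictMono_right (x : Ordinal.{0}) : StrictMono (hessenberg x) := by
  intro y z h
  obtain ⟨e, he, ha⟩ := lt_iff_CNF_coeff.1 h
  refine CNF_eval_lt_of_lex (CNF_coeff_add_lt_omega0 x y) (e := e) ?_ fun a h => ?_
  · simp only [Finsupp.add_apply]
    gcongr
  · simp [ha a h]

lemma hessenberg_lt_of_lt_of_le {x x' y y' : Ordinal.{0}} (hx : x < x') (hy : y ≤ y') :
    hessenberg x y < hessenberg x' y' := by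
  refine ((hessenberg_strictMono_right x).monotone hy).trans_lt ?_
  rw [hessenberg_comm x, hessenberg_comm x']
  exact hessenberg_strictMono_right y' hx

/-- Here `e` is the largest exponent at which `a` differs from the natural sum. The witness keeps
the coefficients of `x` above `e`, lowers the one at `e` by 1, and copies those of `a` below `e`. -/
lemma exists_le_hessenberg_of_coeff_pos {a x y e : Ordinal.{0}}
    (he : CNF.coeff ω a e < (CNF.coeff ω x + CNF.coeff ω y) e)
    (h : ∀ b, e < b → CNF.coeff ω a b = (CNF.coeff ω x + CNF.coeff ω y) b)
    (hpos : 0 < CNF.coeff ω x e) : ∃ x' < x, a ≤ hessenberg x' y := by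
  obtain ⟨m, hm⟩ := lt_omega0.1 (CNF_coeff_lt_omega0 x e)
  obtain ⟨n, hn⟩ := lt_omega0.1 (CNF_coeff_lt_omega0 y e)
  obtain ⟨k, hk⟩ := lt_omega0.1 (CNF_coeff_lt_omega0 a e)
  rw [hm] at hpos
  have hpos : 0 < m := by exact_mod_cast hpos
  simp only [Finsupp.add_apply, hm, hn, hk] at he
  have he : k < m + n := by exact_mod_cast he
  let f : Ordinal.{0} →₀ Ordinal.{0} := (CNF.coeff ω x).filter (e < ·) +
    (Finsupp.single e ((m - 1 : ℕ) : Ordinal) + (CNF.coeff ω a).filter (· < e))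
  have f1 : ∀ b, e < b → f b = CNF.coeff ω x b := fun b hb => by
    simp [f, hb, hb.not_gt, hb.ne]
  have f2 : f e = (m - 1 : ℕ) := by simp [f]
  have f3 : ∀ b, b < e → f b = CNF.coeff ω a b := fun b hb => by
    simp [f, hb, hb.not_gt, hb.ne']
  have hf : ∀ b, f b < ω := by
    intro b
    rcases lt_trichotomy b e with hb | rfl | hb
    · rw [f3 b hb]; exact CNF_coeff_lt_omega0 _ _
    · rw [f2]; exact natCast_lt_omega0 _
    · rw [f1 b hb]; exact CNF_coeff_lt_omega0 _ _
  have hcf : CNF.coeff ω (CNF.eval ω f) = f := CNF.coeff_eval one_lt_omega0 hf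
  refine ⟨CNF.eval ω f, ?_, ?_⟩
  · rw [lt_iff_CNF_coeff, hcf]
    refine ⟨e, ?_, f1⟩
    rw [f2, hm]
    exact_mod_cast (by omega : m - 1 < m)
  · conv_lhs => rw [← CNF.eval_coeff ω a]
    refine CNF_eval_mono (CNF_coeff_lt_omega0 a) (CNF_coeff_add_lt_omega0 _ _) fun b => ?_
    rw [Finsupp.add_apply, hcf]
    rcases lt_trichotomy b e with hb | rfl | hb
    · rw [f3 b hb]; exact le_self_add
    · rw [f2, hk, hn]
      exact_mod_cast (by omega : k ≤ m - 1 + n)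
    · rw [f1 b hb, h b hb, Finsupp.add_apply]

lemma exists_le_hessenberg_of_lt {a x y : Ordinal.{0}} (h : a < hessenberg x y) :
    (∃ x' < x, a ≤ hessenberg x' y) ∨ ∃ y' < y, a ≤ hessenberg x y' := by
  rw [← CNF.eval_coeff ω a] at h
  obtain ⟨e, he, hlt⟩ :=
    (CNF_eval_lt_iff (CNF_coeff_lt_omega0 a) (CNF_coeff_add_lt_omega0 x y)).1 h
  rcases eq_zero_or_pos (CNF.coeff ω x e) with hx | hx
  · right
    -- Ordinal addition is not commutative, but these coefficients are finite; the identity is read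
    -- off from `hessenberg_comm`.
    have hcomm : CNF.coeff ω x + CNF.coeff ω y = CNF.coeff ω y + CNF.coeff ω x := by
      rw [← CNF.coeff_eval one_lt_omega0 (CNF_coeff_add_lt_omega0 x y),
        ← CNF.coeff_eval one_lt_omega0 (CNF_coeff_add_lt_omega0 y x)]
      exact congrArg _ (hessenberg_comm x y)
    rw [hcomm] at he hlt
    simp_rw [hessenberg_comm x]
    refine exists_le_hessenberg_of_coeff_pos he hlt ?_
    rw [Finsupp.add_apply, hx, add_zero] at he
    exact he.pos
  · exact .inl (exists_le_hessenberg_of_coeff_pos he hlt hx)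

/-- As long as the natural sum exceeds `a`, one summand can be lowered without falling below `a`;
well-foundedness stops the descent at equality. -/
lemma exists_hessenberg_eq {a x y : Ordinal.{0}} (h : a ≤ hessenberg x y) :
    ∃ x' ≤ x, ∃ y' ≤ y, hessenberg x' y' = a := by
  induction hv : hessenberg x y using WellFoundedLT.induction generalizing x y with
  | ind v ih =>
    subst hv
    rcases h.eq_or_lt with rfl | hlt
    · exact ⟨x, le_rfl, y, le_rfl, rfl⟩
    rcases exists_le_hessenberg_of_lt hlt with ⟨x', hx, hle⟩ | ⟨y', hy, hle⟩
    · obtain ⟨x₁, h1, y₁, h2, h3⟩ := ih _ (hessenberg_lt_of_lt_of_le hx le_rfl) hle rfl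
      exact ⟨x₁, h1.trans hx.le, y₁, h2, h3⟩
    · obtain ⟨x₁, h1, y₁, h2, h3⟩ := ih _ (hessenberg_strictMono_right x hy) hle rfl
      exact ⟨x₁, h1, y₁, h2.trans hy.le, h3⟩

lemma le_hessenberg_left (x y : Ordinal.{0}) : x ≤ hessenberg x y := by
  conv_lhs => rw [← hessenberg_zero_right x]
  exact (hessenberg_strictMono_right x).monotone zero_le

lemma le_hessenberg_right (x y : Ordinal.{0}) : y ≤ hessenberg x y := by
  rw [hessenberg_comm]
  exact le_hessenberg_left y x

end NaturalSum

/-! ### Initial segments -/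

lemma Init.refl (E : Finset ℕ) : Init E E := ⟨subset_rfl, by simp [Below]⟩

lemma Init.trans {E G H : Finset ℕ} (h1 : Init E G) (h2 : Init G H) : Init E H := by
  refine ⟨h1.1.trans h2.1, fun a ha b hb => ?_⟩
  rw [Finset.mem_sdiff] at hb
  by_cases hG : b ∈ G
  · exact h1.2 a ha b (Finset.mem_sdiff.2 ⟨hG, hb.2⟩)
  · exact h2.2 a (h1.1 ha) b (Finset.mem_sdiff.2 ⟨hb.1, hG⟩)

lemma Init.antisymm {E G : Finset ℕ} (h1 : Init E G) (h2 : Init G E) : E = G :=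
  h1.1.antisymm h2.1

lemma init_empty (E : Finset ℕ) : Init ∅ E := ⟨by simp, by simp [Below]⟩

lemma Init.trans_pInit {E G H : Finset ℕ} (h1 : Init E G) (h2 : PInit G H) : PInit E H :=
  ⟨h1.trans h2.1, fun h => h2.2 (h2.1.antisymm (h ▸ h1))⟩

lemma below_singleton {E : Finset ℕ} {n : ℕ} : Below E {n} ↔ ∀ a ∈ E, a < n := by
  simp [Below]

lemma Below.notMem {E : Finset ℕ} {n : ℕ} (h : Below E {n}) : n ∉ E := fun hn =>
  (below_singleton.1 h n hn).false

lemma eventually_below (E : Finset ℕ) : ∀ᶠ n in Filter.atTop, Below E {n} := by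
  filter_upwards [Filter.eventually_gt_atTop (E.sup id)] with n hn
  exact below_singleton.2 fun a ha => (Finset.le_sup (f := id) ha).trans_lt hn

lemma Below.init_insert {E : Finset ℕ} {n : ℕ} (h : Below E {n}) : Init E (insert n E) := by
  refine ⟨Finset.subset_insert _ _, fun a ha b hb => ?_⟩
  obtain ⟨rfl | hb, hb'⟩ := by simpa using hb
  · exact below_singleton.1 h a ha
  · exact absurd hb hb'

lemma Below.pInit_insert {E : Finset ℕ} {n : ℕ} (h : Below E {n}) : PInit E (insert n E) :=
  ⟨h.init_insert, fun he => h.notMem (he ▸ Finset.mem_insert_self n E)⟩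

lemma Init.eq_or_of_insert {D E : Finset ℕ} {n : ℕ} (hn : Below E {n})
    (h : Init D (insert n E)) : D = insert n E ∨ Init D E := by
  by_cases hD : n ∈ D
  · left
    refine h.1.antisymm fun x hx => ?_
    by_contra hxD
    have h1 := h.2 n hD x (Finset.mem_sdiff.2 ⟨hx, hxD⟩)
    rcases Finset.mem_insert.1 hx with rfl | hx
    · exact hxD hD
    · exact h1.asymm (below_singleton.1 hn x hx)
  · right
    refine ⟨fun x hx => ?_, fun a ha b hb => h.2 a ha b ?_⟩
    · rcases Finset.mem_insert.1 (h.1 hx) with rfl | hx'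
      · exact absurd hx hD
      · exact hx'
    · simp_all

lemma PInit.exists_insert {E G : Finset ℕ} (h : PInit E G) :
    ∃ n, Below E {n} ∧ Init (insert n E) G := by
  have hne : (G \ E).Nonempty := by
    rw [Finset.sdiff_nonempty]
    exact fun hs => h.2 (h.1.1.antisymm hs)
  have hmem := Finset.min'_mem _ hne
  refine ⟨(G \ E).min' hne, below_singleton.2 fun a ha => h.1.2 a ha _ hmem,
    Finset.insert_subset (Finset.sdiff_subset hmem) h.1.1, fun a ha b hb => ?_⟩
  have hb' : b ∈ G ∧ b ≠ (G \ E).min' hne ∧ b ∉ E := by simpa using hb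
  have hb2 : b ∈ G \ E := Finset.mem_sdiff.2 ⟨hb'.1, hb'.2.2⟩
  rcases Finset.mem_insert.1 ha with rfl | ha
  · exact ((G \ E).min'_le b hb2).lt_of_ne hb'.2.1.symm
  · exact h.1.2 a ha b hb2

lemma Init.insert_unique {E G : Finset ℕ} {m n : ℕ} (hm : Below E {m}) (hn : Below E {n})
    (h1 : Init (insert m E) G) (h2 : Init (insert n E) G) : m = n := by
  have key : ∀ m n, Below E {m} → Below E {n} → Init (insert m E) G → Init (insert n E) G →
      ¬ m < n := fun m n hm hn h1 h2 hlt => by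
    refine hlt.asymm (h2.2 n (by simp) m (Finset.mem_sdiff.2 ⟨h1.1 (by simp), ?_⟩))
    simp [hlt.ne, hm.notMem]
  exact le_antisymm (not_lt.1 (key n m hn hm h2 h1)) (not_lt.1 (key m n hm hn h1 h2))

/-- The branching point `D` is the common part below the least element `x` of the symmetric
difference. If both sets continued `D` by the same element, it would have to be `x`, which lies in
only one of them. -/
lemma init_or_init_or_split (E G : Finset ℕ) : Init E G ∨ Init G E ∨
    ∃ D m n, m ≠ n ∧ Below D {m} ∧ Below D {n} ∧ Init (insert m D) E ∧ Init (insert n D) G := by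
  rcases (symmDiff E G).eq_empty_or_nonempty with he | hne
  · rw [← Finset.bot_eq_empty, symmDiff_eq_bot] at he
    exact .inl (he ▸ .refl _)
  · set x := (symmDiff E G).min' hne with hx
    have hagree : ∀ y < x, y ∈ E ↔ y ∈ G := by
      intro y hy
      by_contra hc
      refine hy.not_ge (Finset.min'_le _ _ ?_)
      rw [Finset.mem_symmDiff]
      tauto
    have hD : E.filter (· < x) = G.filter (· < x) := by
      ext y
      simp only [Finset.mem_filter]
      constructor <;> rintro ⟨h1, h2⟩ <;> simp_all
    have hI : ∀ H : Finset ℕ, Init (H.filter (· < x)) H := fun H => by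
      refine ⟨Finset.filter_subset _ _, fun a ha b hb => ?_⟩
      simp at ha hb
      exact ha.2.trans_le (hb.2 hb.1)
    have hE := hI E
    have hG := hI G
    rw [← hD] at hG
    by_cases h1 : E.filter (· < x) = E
    · exact .inl (h1 ▸ hG)
    by_cases h2 : E.filter (· < x) = G
    · exact .inr (.inl (h2 ▸ hE))
    obtain ⟨m, hm, hmE⟩ := PInit.exists_insert ⟨hE, h1⟩
    obtain ⟨n, hn, hnG⟩ := PInit.exists_insert ⟨hG, h2⟩
    refine .inr (.inr ⟨_, m, n, ?_, hm, hn, hmE, hnG⟩)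
    rintro rfl
    have hxm : ∀ H : Finset ℕ, x ∈ H → E.filter (· < x) = H.filter (· < x) →
        Init (insert m (E.filter (· < x))) H → m ≤ x := fun H hxH hEH hI => by
      by_contra! hlt
      refine hlt.asymm (hI.2 m (by simp) x (Finset.mem_sdiff.2 ⟨hxH, ?_⟩))
      simp [hlt.ne]
    have hmx : ¬ m < x := fun hlt => hm.notMem (Finset.mem_filter.2 ⟨hmE.1 (by simp), hlt⟩)
    have hmem := Finset.min'_mem _ hne
    rw [← hx, Finset.mem_symmDiff] at hmem
    rcases hmem with ⟨h3, h4⟩ | ⟨h3, h4⟩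
    · obtain rfl : m = x := le_antisymm (hxm E h3 rfl hmE) (not_lt.1 hmx)
      exact h4 (hnG.1 (by simp))
    · obtain rfl : m = x := le_antisymm (hxm G h3 hD hnG) (not_lt.1 hmx)
      exact h4 (hmE.1 (by simp))

/-! ### Monochromatic trees -/

/-- Above `E` there is an infinitely branching tree of rank at least `α`, whose branches end in
elements of `L`, such that each node `c` above `E` satisfies `H ∈ C c` for each of the end points
`H` above it. -/
def MonoTree (C : Finset ℕ → Set (Finset ℕ)) (L : Set (Finset ℕ)) (E : Finset ℕ)
    (α : Ordinal.{0}) : Prop :=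
  (∃ H ∈ L, Init E H) ∧ ∀ β, β < α → ∃ᶠ n in Filter.atTop, Below E {n} ∧
    ∃ c, Init (insert n E) c ∧ MonoTree C (L ∩ C c) c β
termination_by α

/-- `n` is a successor of `E` above which there is a node of a monochromatic tree, of rank at
least `β`. -/
def HasNode (C : Finset ℕ → Set (Finset ℕ)) (L : Set (Finset ℕ)) (E : Finset ℕ)
    (β : Ordinal.{0}) (n : ℕ) : Prop :=
  Below E {n} ∧ ∃ c, Init (insert n E) c ∧ MonoTree C (L ∩ C c) c β

section MonoTree
variable {C : Finset ℕ → Set (Finset ℕ)} {L L' L₁ L₂ : Set (Finset ℕ)} {E : Finset ℕ}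
  {α β : Ordinal.{0}} {n : ℕ}

lemma monoTree_iff : MonoTree C L E α ↔
    (∃ H ∈ L, Init E H) ∧ ∀ β < α, ∃ᶠ n in Filter.atTop, HasNode C L E β n := by
  rw [MonoTree]
  rfl

lemma MonoTree.of_le (h : MonoTree C L E α) (hβ : β ≤ α) : MonoTree C L E β := by
  rw [monoTree_iff] at h ⊢
  exact ⟨h.1, fun γ hγ => h.2 γ (hγ.trans_le hβ)⟩

lemma MonoTree.mono (h : MonoTree C L E α) (hL : L ⊆ L') : MonoTree C L' E α := by
  induction α using WellFoundedLT.induction generalizing L L' E with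
  | ind α ih =>
    rw [monoTree_iff] at h ⊢
    obtain ⟨⟨H, hH, hEH⟩, h⟩ := h
    refine ⟨⟨H, hL hH, hEH⟩, fun β hβ => (h β hβ).mono ?_⟩
    rintro n ⟨hn, c, hc, hcT⟩
    exact ⟨hn, c, hc, ih β hβ hcT (Set.inter_subset_inter_left _ hL)⟩

lemma HasNode.exists_leaf (h : HasNode C L E α n) : ∃ H ∈ L, Init E H := by
  obtain ⟨hn, c, hc, hT⟩ := h
  obtain ⟨⟨H, hH, hcH⟩, -⟩ := monoTree_iff.1 hT
  exact ⟨H, hH.1, hn.init_insert.trans (hc.trans hcH)⟩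

/-- Rank is partition regular in the set of end points. If `L₁` fails at some level `γ < α`, then
almost no successor has an `L₁`-node of rank `γ`. By induction, successors with nodes of rank `max β
γ` then have `L₂`-nodes of rank at least `β`. -/
lemma MonoTree.or_of_subset_union (h : MonoTree C L E α)
    (hL : ∀ H ∈ L, Init E H → H ∈ L₁ ∪ L₂) : MonoTree C L₁ E α ∨ MonoTree C L₂ E α := by
  induction α using WellFoundedLT.induction generalizing L L₁ L₂ E with
  | ind α ih =>
    rw [monoTree_iff] at h
    obtain ⟨⟨H, hH, hEH⟩, h⟩ := h
    rcases eq_zero_or_pos α with rfl | hα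
    · refine (hL H hH hEH).imp ?_ ?_ <;> intro hH' <;> rw [monoTree_iff] <;>
        exact ⟨⟨H, hH', hEH⟩, fun β hβ => absurd hβ (by simp)⟩
    by_cases h1 : ∀ β < α, ∃ᶠ n in Filter.atTop, HasNode C L₁ E β n
    · left
      obtain ⟨n, hn⟩ := (h1 0 hα).exists
      exact monoTree_iff.2 ⟨hn.exists_leaf, h1⟩
    right
    push Not at h1
    obtain ⟨γ, hγ, hfin⟩ := h1
    have h2 : ∀ β < α, ∃ᶠ n in Filter.atTop, HasNode C L₂ E β n := fun β hβ => by
      refine ((h _ (max_lt hβ hγ)).and_eventually hfin).mono ?_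
      rintro n ⟨⟨hn, c, hc, hT⟩, hnot⟩
      have := ih _ (max_lt hβ hγ) hT (L₁ := L₁ ∩ C c) (L₂ := L₂ ∩ C c) fun H hH hcH =>
        (hL H hH.1 (hn.init_insert.trans (hc.trans hcH))).imp (⟨·, hH.2⟩) (⟨·, hH.2⟩)
      rcases this with hT | hT
      · exact absurd ⟨hn, c, hc, hT.of_le (le_max_right _ _)⟩ hnot
      · exact ⟨hn, c, hc, hT.of_le (le_max_left _ _)⟩
    obtain ⟨n, hn⟩ := (h2 0 hα).exists
    exact monoTree_iff.2 ⟨hn.exists_leaf, h2⟩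

/-- The maximal rank `s` is the least level at which almost all successors lack a node; below it
nodes occur frequently. -/
lemma monoTree_or_exists_maximal (hleaf : ∃ H ∈ L, Init E H) (α : Ordinal.{0}) :
    MonoTree C L E α ∨
      ∃ s, MonoTree C L E s ∧ ∀ᶠ n in Filter.atTop, ¬ HasNode C L E s n := by
  by_cases h : ∃ s, ∀ᶠ n in Filter.atTop, ¬ HasNode C L E s n
  · right
    obtain ⟨s, hs, hmin⟩ := WellFounded.has_min (wellFounded_lt (α := Ordinal.{0})) _ h
    exact ⟨s, monoTree_iff.2 ⟨hleaf, fun β hβ hev => hmin β hev hβ⟩, hs⟩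
  · left
    push Not at h
    exact monoTree_iff.2 ⟨hleaf, fun β _ => h β⟩

/-- The inequality is strict because the end points already have the color at `c`, so `c` itself
would serve as a node of rank `s`. -/
lemma lt_of_not_hasNode {c : Finset ℕ} {s : Ordinal.{0}} (hs : ¬ HasNode C L E s n)
    (hn : Below E {n}) (hc : Init (insert n E) c) (h : MonoTree C (L ∩ C c) c α) : α < s := by
  by_contra! hle
  exact hs ⟨hn, c, hc, h.of_le hle⟩

/-- Here `c` need not have the color in question. A tree of rank above `s` at `c` still contains a
node of rank `s` strictly above `c`, and this node lies over the same successor `n` of `E`. -/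
lemma le_of_not_hasNode {c : Finset ℕ} {s : Ordinal.{0}} (hs : ¬ HasNode C L E s n)
    (hn : Below E {n}) (hc : Init (insert n E) c) (h : MonoTree C L' c α) (hL : L' ⊆ L) :
    α ≤ s := by
  by_contra! hlt
  obtain ⟨m, hm, c', hc', hT⟩ := ((monoTree_iff.1 h).2 s hlt).exists
  exact hs ⟨hn, c', hc.trans (hm.init_insert.trans hc'),
    hT.mono (Set.inter_subset_inter_left _ hL)⟩

/-- The coloring lemma for trees. -/
theorem MonoTree.exists_le_hessenberg {C₀ C₁ : Finset ℕ → Set (Finset ℕ)}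
    (hC : ∀ c, c ≠ ∅ → ∀ H ∈ L, Init c H → H ∈ C₀ c ∪ C₁ c)
    (h : MonoTree (fun _ => Set.univ) L E α) :
    ∃ x y, α ≤ hessenberg x y ∧ MonoTree C₀ L E x ∧ MonoTree C₁ L E y := by
  induction α using WellFoundedLT.induction generalizing L E with
  | ind α ih =>
    have hleaf := (monoTree_iff.1 h).1
    have h0 : ∀ C, MonoTree C L E 0 := fun C =>
      monoTree_iff.2 ⟨hleaf, fun β hβ => absurd hβ (by simp)⟩
    rcases monoTree_or_exists_maximal (C := C₀) hleaf α with h1 | ⟨x, hx, hxn⟩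
    · exact ⟨α, 0, (hessenberg_zero_right α).ge, h1, h0 _⟩
    rcases monoTree_or_exists_maximal (C := C₁) hleaf α with h1 | ⟨y, hy, hyn⟩
    · exact ⟨0, α, (hessenberg_zero_left α).ge, h0 _, h1⟩
    refine ⟨x, y, ?_, hx, hy⟩
    by_contra! hlt
    -- Uncolored nodes of rank `x ⊕ y` are frequent, whereas both failures hold for almost every
    -- successor, so all three meet at one `n`.
    obtain ⟨n, ⟨hn, c, hc, hT⟩, hxn, hyn⟩ :=
      (((monoTree_iff.1 h).2 _ hlt).and_eventually (hxn.and hyn)).exists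
    have hne : c ≠ ∅ := Finset.ne_empty_of_mem (hc.1 (Finset.mem_insert_self n E))
    rcases hT.or_of_subset_union (L₁ := L ∩ C₀ c) (L₂ := L ∩ C₁ c) fun H hH hcH =>
      (hC c hne H hH.1 hcH).imp (⟨hH.1, ·⟩) (⟨hH.1, ·⟩) with hT | hT
    · obtain ⟨x', y', hle, hx', hy'⟩ := ih _ hlt (fun c hc H hH => hC c hc H hH.1) hT
      exact (hessenberg_lt_of_lt_of_le (lt_of_not_hasNode hxn hn hc hx')
        (le_of_not_hasNode hyn hn hc hy' Set.inter_subset_left)).not_ge hle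
    · obtain ⟨x', y', hle, hx', hy'⟩ := ih _ hlt (fun c hc H hH => hC c hc H hH.1) hT
      rw [hessenberg_comm x', hessenberg_comm x] at hle
      exact (hessenberg_lt_of_lt_of_le (lt_of_not_hasNode hyn hn hc hy')
        (le_of_not_hasNode hxn hn hc hx' Set.inter_subset_left)).not_ge hle

end MonoTree

/-! ### Derivatives of regular families -/

section Derivative
variable {F : Set (Finset ℕ)}

lemma deriv_zero (F : Set (Finset ℕ)) : deriv F 0 = F := by
  simp [deriv]

lemma deriv_add_one (F : Set (Finset ℕ)) (ξ : Ordinal.{0}) :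
    deriv F (ξ + 1) = deriv F ξ \ MAX (deriv F ξ) := by
  simp [deriv]

lemma deriv_limit (F : Set (Finset ℕ)) {ξ : Ordinal.{0}} (h : Order.IsSuccLimit ξ) :
    deriv F ξ = ⋂ (ζ) (_ : ζ < ξ), deriv F ζ := by
  rw [deriv, Ordinal.limitRecOn_limit _ _ _ _ h]
  rfl

lemma mem_deriv_of_lt {E : Finset ℕ} {ξ ζ : Ordinal.{0}} (hE : E ∈ deriv F ξ) (h : ζ < ξ) :
    E ∈ deriv F (ζ + 1) := by
  induction ξ using Ordinal.limitRecOn with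
  | zero => exact absurd h (by simp)
  | add_one ξ ih =>
    rcases (Order.lt_add_one_iff.1 h).eq_or_lt with rfl | hlt
    · exact hE
    · rw [deriv_add_one] at hE
      exact ih hE.1 hlt
  | limit ξ hξ _ =>
    rw [deriv_limit F hξ] at hE
    exact Set.mem_iInter₂.1 hE _ (hξ.add_one_lt h)

lemma deriv_subset (F : Set (Finset ℕ)) (ξ : Ordinal.{0}) : deriv F ξ ⊆ F := by
  intro E hE
  rcases eq_zero_or_pos ξ with rfl | h
  · rwa [deriv_zero] at hE
  · have := mem_deriv_of_lt hE h
    rw [deriv_add_one, deriv_zero] at this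
    exact this.1

lemma IsHereditary.mem_of_init (hF : IsHereditary F) {E G : Finset ℕ} (hG : G ∈ F)
    (h : Init E G) : E ∈ F := hF G hG E h.1

lemma deriv_mem_of_init (hF : IsHereditary F) {E G : Finset ℕ} {ξ : Ordinal.{0}}
    (hG : G ∈ deriv F ξ) (h : Init E G) : E ∈ deriv F ξ := by
  induction ξ using Ordinal.limitRecOn with
  | zero => rw [deriv_zero] at *; exact hF.mem_of_init hG h
  | add_one ξ ih =>
    rw [deriv_add_one] at *
    by_cases he : E = G
    · exact he ▸ hG
    · exact ⟨ih hG.1, fun hE => hE.2 G hG.1 ⟨h, he⟩⟩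
  | limit ξ hξ ih =>
    rw [deriv_limit F hξ] at *
    exact Set.mem_iInter₂.2 fun ζ hζ => ih ζ hζ (Set.mem_iInter₂.1 hG ζ hζ)

lemma PInit.image {E G : Finset ℕ} (h : PInit E G) {f : ℕ → ℕ} (hf : StrictMono f) :
    PInit (E.image f) (G.image f) := by
  refine ⟨⟨Finset.image_subset_image h.1.1, fun x hx y hy => ?_⟩,
    fun he => h.2 (Finset.image_injective hf.injective he)⟩
  rw [← Finset.image_sdiff _ _ hf.injective] at hy
  obtain ⟨a, ha, rfl⟩ := Finset.mem_image.1 hx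
  obtain ⟨b, hb, rfl⟩ := Finset.mem_image.1 hy
  exact hf (h.1.2 a ha b hb)

lemma isSpread_image (E : Finset ℕ) {f : ℕ → ℕ} (hf : StrictMono f) :
    IsSpread (E.image f) E := by
  have hE : Finset.univ.image (E.orderEmbOfFin rfl) = E := by
    rw [← Finset.coe_inj]
    simp
  refine ⟨E.card, E.orderEmbOfFin rfl, f ∘ E.orderEmbOfFin rfl, (E.orderEmbOfFin rfl).strictMono,
    hf.comp (E.orderEmbOfFin rfl).strictMono, fun i => hf.le_apply, hE.symm, ?_⟩
  rw [← Finset.image_image, hE]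

/-- A proper extension inside a derivative is carried by `f` to a proper extension of the image, so
non-maximality survives. -/
lemma deriv_image_mem (hF : IsSpreading F) {E : Finset ℕ} {ξ : Ordinal.{0}}
    (hE : E ∈ deriv F ξ) {f : ℕ → ℕ} (hf : StrictMono f) : E.image f ∈ deriv F ξ := by
  induction ξ using Ordinal.limitRecOn generalizing E with
  | zero => rw [deriv_zero] at *; exact hF E hE _ (isSpread_image E hf)
  | add_one ξ ih =>
    rw [deriv_add_one] at *
    refine ⟨ih hE.1, fun hmax => hE.2 ⟨hE.1, fun G hG hEG => ?_⟩⟩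
    exact hmax.2 _ (ih hG) (hEG.image hf)
  | limit ξ hξ ih =>
    rw [deriv_limit F hξ] at *
    exact Set.mem_iInter₂.2 fun ζ hζ => ih ζ hζ (Set.mem_iInter₂.1 hE ζ hζ)

lemma deriv_insert_mem (hF : IsSpreading F) {E : Finset ℕ} {m n : ℕ} {ξ : Ordinal.{0}}
    (hm : Below E {m}) (hmn : m ≤ n) (hE : insert m E ∈ deriv F ξ) :
    insert n E ∈ deriv F ξ := by
  -- This map fixes `E`, which lies below `m`, and sends `m` to `n`.
  have hf : StrictMono fun x => if x < m then x else x + (n - m) := by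
    intro a b hab
    dsimp only
    split_ifs <;> omega
  have himage := deriv_image_mem hF hE hf
  have hE' : E.image (fun x => if x < m then x else x + (n - m)) = E := by
    conv_rhs => rw [← Finset.image_id (s := E)]
    refine Finset.image_congr fun x hx => ?_
    simp [below_singleton.1 hm x hx]
  rwa [Finset.image_insert, hE', if_neg (lt_irrefl m), Nat.add_sub_cancel' hmn] at himage

/-- Compactness excludes infinite branches. -/
lemma IsRegular.exists_mem_MAX (hF : IsRegular F) {E : Finset ℕ} (hE : E ∈ F) :
    ∃ H ∈ MAX F, Init E H := by
  by_contra! hno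
  have hstep : ∀ G : {G // G ∈ F ∧ Init E G}, ∃ G' : {G // G ∈ F ∧ Init E G},
      PInit G.1 G'.1 := by
    rintro ⟨G, hG, hEG⟩
    have hGM : G ∉ MAX F := fun h => hno G h hEG
    simp only [MAX, Set.mem_ofPred_eq, not_and, not_forall, not_not] at hGM
    obtain ⟨G', hG', h⟩ := hGM hG
    exact ⟨⟨G', hG', hEG.trans h.1⟩, h⟩
  choose f hf using hstep
  let s : ℕ → {G // G ∈ F ∧ Init E G} := fun n => f^[n] ⟨E, hE, .refl E⟩
  have hs : ∀ n, PInit (s n).1 (s (n + 1)).1 := fun n => by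
    simp only [s, Function.iterate_succ_apply']
    exact hf _
  have hmono : Monotone fun n => (s n).1 := monotone_nat_of_le_succ fun n => (hs n).1.1
  have hcard : ∀ n, n ≤ (s n).1.card := by
    intro n
    induction n with
    | zero => simp
    | succ n ih =>
      exact ih.trans_lt (Finset.card_lt_card ((hs n).1.1.ssubset_of_ne (hs n).2))
  classical
  have hlim : Filter.Tendsto (fun n => toCantor (s n).1) Filter.atTop
      (nhds fun x => decide (∃ n, x ∈ (s n).1)) := by
    rw [tendsto_pi_nhds]
    intro x
    refine tendsto_const_nhds.congr' ?_
    by_cases hx : ∃ n, x ∈ (s n).1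
    · obtain ⟨n, hn⟩ := id hx
      filter_upwards [Filter.eventually_ge_atTop n] with k hk
      simp [toCantor, hx, hmono hk hn]
    · refine Filter.Eventually.of_forall fun k => ?_
      have hk : x ∉ (s k).1 := fun h => hx ⟨k, h⟩
      simp [toCantor, hx, hk]
  -- The limit of the strictly increasing chain is its union; closedness makes it a finite set `G`,
  -- although the cardinalities in the chain are unbounded.
  obtain ⟨G, -, hG⟩ := hF.compact.isClosed.mem_of_tendsto hlim
    (Filter.Eventually.of_forall fun n => ⟨_, (s n).2.1, rfl⟩)
  have hsub : (s (G.card + 1)).1 ⊆ G := fun x hx => by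
    have := congrFun hG x
    simp only [toCantor, decide_eq_decide] at this
    exact this.2 ⟨_, hx⟩
  have := (hcard (G.card + 1)).trans (Finset.card_le_card hsub)
  omega

lemma hasNode_univ {L : Set (Finset ℕ)} {E : Finset ℕ} {n : ℕ} {β : Ordinal.{0}}
    (hn : Below E {n}) (h : MonoTree (fun _ => Set.univ) L (insert n E) β) :
    HasNode (fun _ => Set.univ) L E β n :=
  ⟨hn, _, .refl _, by simpa using h⟩

/-- One proper extension inside the derivative gives one successor `m`; spreading then gives every
larger `n`, hence infinite branching. -/
lemma frequently_hasNode_of_pInit (hF : IsRegular F) {E G : Finset ℕ} {β : Ordinal.{0}}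
    (ih : ∀ H ∈ deriv F β, MonoTree (fun _ => Set.univ) (MAX F) H β)
    (hG : G ∈ deriv F β) (h : PInit E G) :
    ∃ᶠ n in Filter.atTop, HasNode (fun _ => Set.univ) (MAX F) E β n := by
  obtain ⟨m, hm, hmG⟩ := h.exists_insert
  have hmem := deriv_mem_of_init hF.hereditary hG hmG
  refine Filter.Eventually.frequently ?_
  filter_upwards [Filter.eventually_ge_atTop m, eventually_below E] with n hn hEn
  exact hasNode_univ hEn (ih _ (deriv_insert_mem hF.spreading hm hn hmem))

lemma IsRegular.monoTree_of_mem_deriv (hF : IsRegular F) {ξ : Ordinal.{0}} :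
    ∀ E ∈ deriv F ξ, MonoTree (fun _ => Set.univ) (MAX F) E ξ := by
  induction ξ using WellFoundedLT.induction with
  | ind ξ ih =>
    intro E hE
    refine monoTree_iff.2 ⟨hF.exists_mem_MAX (deriv_subset F ξ hE), fun β hβ => ?_⟩
    have hEβ := mem_deriv_of_lt hE hβ
    rw [deriv_add_one] at hEβ
    have hnot := hEβ.2
    simp only [MAX, Set.mem_ofPred_eq, not_and, not_forall, not_not] at hnot
    obtain ⟨G, hG, hEG⟩ := hnot hEβ.1
    exact frequently_hasNode_of_pInit hF (ih β hβ) hG hEG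

/-- The infimum of the empty set of ordinals is 0, so positivity forces the defining set to be
non-empty. -/
lemma iota_spec (h : 0 < iota F) : iota F < ω₁ ∧ deriv F (iota F) ⊆ {∅} := by
  refine csInf_mem (s := {ξ | ξ < ω₁ ∧ deriv F ξ ⊆ {∅}}) (Set.nonempty_iff_ne_empty.2 fun he => ?_)
  rw [iota, he, Ordinal.sInf_empty] at h
  exact h.false

lemma IsRegular.monoTree_iota (hF : IsRegular F) (hpos : 0 < iota F) :
    MonoTree (fun _ => Set.univ) (MAX F) ∅ (iota F) := by
  have hfreq : ∀ β < iota F, ∃ᶠ n in Filter.atTop,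
      HasNode (fun _ => Set.univ) (MAX F) ∅ β n := fun β hβ => by
    have hnot : ¬ deriv F β ⊆ {∅} := fun h =>
      hβ.not_ge (csInf_le' ⟨hβ.trans (iota_spec hpos).1, h⟩)
    obtain ⟨G, hG, hne⟩ := Set.not_subset.1 hnot
    exact frequently_hasNode_of_pInit hF hF.monoTree_of_mem_deriv hG
      ⟨init_empty G, fun h => hne h.symm⟩
  obtain ⟨n, hn⟩ := (hfreq 0 hpos).exists
  exact monoTree_iff.2 ⟨hn.exists_leaf, hfreq⟩

end Derivative

/-! ### Fine Schreier families -/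

/-- `E` without its least element. -/
def tail (E : Finset ℕ) : Finset ℕ := E.filter fun x => ∃ y ∈ E, y < x

lemma mem_tail {E : Finset ℕ} {x : ℕ} : x ∈ tail E ↔ x ∈ E ∧ ∃ y ∈ E, y < x := by
  simp [tail]

lemma PInit.exists_mem {E G : Finset ℕ} (h : PInit E G) : ∃ x ∈ G, x ∉ E := by
  by_contra! hs
  exact h.2 (h.1.1.antisymm hs)

/-- Non-emptiness matters: `∅` and a singleton have the same tail. -/
lemma PInit.tail {E G : Finset ℕ} (h : PInit E G) (hE : E.Nonempty) :
    PInit (tail E) (tail G) := by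
  refine ⟨⟨fun x hx => ?_, fun a ha b hb => ?_⟩, fun he => ?_⟩
  · obtain ⟨hx, y, hy, hyx⟩ := mem_tail.1 hx
    exact mem_tail.2 ⟨h.1.1 hx, y, h.1.1 hy, hyx⟩
  · obtain ⟨hbG, hbE⟩ := Finset.mem_sdiff.1 hb
    obtain ⟨hbG, y, hy, hyb⟩ := mem_tail.1 hbG
    refine h.1.2 a (mem_tail.1 ha).1 b (Finset.mem_sdiff.2 ⟨hbG, fun hb => hbE ?_⟩)
    refine mem_tail.2 ⟨hb, y, ?_, hyb⟩
    by_contra hyE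
    exact hyb.asymm (h.1.2 b hb y (Finset.mem_sdiff.2 ⟨hy, hyE⟩))
  · obtain ⟨x, hx, hxE⟩ := h.exists_mem
    obtain ⟨y, hy⟩ := hE
    have hxt : x ∈ RegularFamily.tail G :=
      mem_tail.2 ⟨hx, y, h.1.1 hy, h.1.2 y hy x (Finset.mem_sdiff.2 ⟨hx, hxE⟩)⟩
    rw [← he] at hxt
    exact hxE (mem_tail.1 hxt).1

lemma IsHereditary.tail_mem {S : Set (Finset ℕ)} (hS : IsHereditary S) {E : Finset ℕ}
    (hE : E ∈ sumFamily atMostOne S) : tail E ∈ S := by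
  obtain ⟨A, hA, B, hB, hAB, rfl⟩ := hE
  refine hS B hB _ fun x hx => ?_
  obtain ⟨hx, y, hy, hyx⟩ := mem_tail.1 hx
  rcases Finset.mem_union.1 hx with hxA | hxB
  · rcases Finset.mem_union.1 hy with hyA | hyB
    · exact absurd (Finset.card_le_one.1 hA y hyA x hxA) hyx.ne
    · exact absurd (hAB x hxA y hyB) hyx.asymm
  · exact hxB

/-- `ρ` bounds the ranks of the members of the tree `S`. -/
def IsRank (S : Set (Finset ℕ)) (ρ : Finset ℕ → Ordinal.{0}) : Prop :=
  ∀ E ∈ S, ∀ G ∈ S, PInit E G → ρ G < ρ E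

lemma IsRank.le_empty {S : Set (Finset ℕ)} {ρ : Finset ℕ → Ordinal.{0}} (hρ : IsRank S ρ)
    (h0 : ∅ ∈ S) {E : Finset ℕ} (hE : E ∈ S) : ρ E ≤ ρ ∅ := by
  rcases E.eq_empty_or_nonempty with rfl | hne
  · rfl
  · exact (hρ ∅ h0 E hE ⟨init_empty E, hne.ne_empty.symm⟩).le

lemma IsHereditary.diag {G : ℕ → Set (Finset ℕ)} (hG : ∀ n, IsHereditary (G n)) :
    IsHereditary (diag G) := by
  rintro E ⟨n, hn, hE⟩ H hH
  exact ⟨n, fun x hx => hn x (hH hx), hG n E hE H hH⟩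

lemma IsHereditary.sumFamily {S : Set (Finset ℕ)} (hS : IsHereditary S) :
    IsHereditary (sumFamily atMostOne S) := by
  rintro E ⟨A, hA, B, hB, hAB, rfl⟩ G hG
  refine ⟨A ∩ G, (Finset.card_le_card Finset.inter_subset_left).trans hA, B ∩ G,
    hS _ hB _ Finset.inter_subset_left, fun a ha b hb => ?_, ?_⟩
  · exact hAB a (Finset.mem_inter.1 ha).1 b (Finset.mem_inter.1 hb).1
  · rw [← Finset.union_inter_distrib_right]
    exact (Finset.inter_eq_right.2 hG).symm

lemma sInf_mem_coe {E : Finset ℕ} (hE : E.Nonempty) : sInf (E : Set ℕ) ∈ E := by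
  exact_mod_cast Nat.sInf_mem (s := (E : Set ℕ)) hE

lemma PInit.sInf_eq {E G : Finset ℕ} (h : PInit E G) (hE : E.Nonempty) :
    sInf (G : Set ℕ) = sInf (E : Set ℕ) := by
  refine le_antisymm (Nat.sInf_le (h.1.1 (sInf_mem_coe hE))) ?_
  have hG := sInf_mem_coe (hE.mono h.1.1)
  by_cases hmem : sInf (G : Set ℕ) ∈ E
  · exact Nat.sInf_le hmem
  · exact (h.1.2 _ (sInf_mem_coe hE) _ (Finset.mem_sdiff.2 ⟨hG, hmem⟩)).le

section
variable {S : Ordinal.{0} → Set (Finset ℕ)}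

/-- The fine Schreier family with index `ξ` is a hereditary tree of rank at most `ξ`. -/
theorem IsFineSchreier.hereditary_and_exists_rank (hS : IsFineSchreier S) {ξ : Ordinal.{0}}
    (hξ : ξ < ω₁) : IsHereditary (S ξ) ∧ ∅ ∈ S ξ ∧ ∃ ρ, IsRank (S ξ) ρ ∧ ρ ∅ ≤ ξ := by
  induction ξ using Ordinal.limitRecOn with
  | zero =>
    rw [hS.zero]
    refine ⟨fun E hE G hG => ?_, rfl, fun _ => 0, fun E hE G hG h => ?_, le_rfl⟩
    · rw [Set.mem_singleton_iff] at *
      exact Finset.subset_empty.1 (hE ▸ hG)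
    · rw [Set.mem_singleton_iff] at *
      exact absurd (hE.trans hG.symm) h.2
  | add_one ξ ih =>
    have hlt : ξ < ω₁ := (Order.lt_add_one_iff.2 le_rfl).trans hξ
    obtain ⟨hher, h0, ρ, hρ, hρ0⟩ := ih hlt
    rw [hS.succ ξ hlt]
    -- Deleting the least element leads into the family of index `ξ`, whose rank is used there; the
    -- root receives the new value `ξ + 1`.
    refine ⟨hher.sumFamily, ⟨∅, by simp [atMostOne], ∅, h0, by simp [Below], by simp⟩,
      fun E => if E = ∅ then ξ + 1 else ρ (tail E), fun E hE G hG h => ?_, by simp⟩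
    have hGne : G ≠ ∅ := Finset.ne_empty_of_mem h.exists_mem.choose_spec.1
    dsimp only
    rw [if_neg hGne]
    split_ifs with hE0
    · exact Order.lt_add_one_iff.2 ((hρ.le_empty h0 (hher.tail_mem hG)).trans hρ0)
    · exact hρ _ (hher.tail_mem hE) _ (hher.tail_mem hG)
        (h.tail (Finset.nonempty_iff_ne_empty.2 hE0))
  | limit ξ hlim ih =>
    obtain ⟨η, m, -, hη, -, hmono, heq⟩ := hS.limit ξ hξ hlim
    have hlt : ∀ n, η n + m n < ξ := fun n => hlim.add_natCast_lt (hη n) (m n)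
    have ih' := fun n => ih _ (hlt n) ((hlt n).trans hξ)
    have hmono : Monotone fun n => S (η n + m n) := monotone_nat_of_le_succ hmono
    choose hher h0 ρ hρ hρ0 using ih'
    rw [heq]
    -- The least element of a non-empty member selects a family containing it, since the families
    -- increase. It is constant along non-empty initial segments, so one rank function serves each
    -- branch.
    refine ⟨.diag hher, ⟨0, by simp, h0 0⟩,
      fun E => if E = ∅ then ξ else ρ (sInf (E : Set ℕ)) E, fun E hE G hG h => ?_, by simp⟩
    have hmem : ∀ H : Finset ℕ, H.Nonempty → H ∈ diag (fun n => S (η n + m n)) →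
        H ∈ S (η (sInf (H : Set ℕ)) + m (sInf (H : Set ℕ))) := by
      rintro H hne ⟨n, hn, hH⟩
      exact hmono (hn _ (sInf_mem_coe hne)) hH
    have hGne : G.Nonempty := ⟨_, h.exists_mem.choose_spec.1⟩
    dsimp only
    rw [if_neg hGne.ne_empty]
    split_ifs with hE0
    · exact (((hρ _).le_empty (h0 _) (hmem G hGne hG)).trans (hρ0 _)).trans_lt (hlt _)
    · have hEne := Finset.nonempty_iff_ne_empty.2 hE0
      have hG' := hmem G hGne hG
      rw [h.sInf_eq hEne] at hG' ⊢
      exact hρ _ E (hmem E hEne hE) G hG' h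

end

/-! ### Embedding trees into monochromatic trees -/

/-- Recursion along a finite increasing sequence. -/
noncomputable def seqRec {α : Type*} (a : α) (step : Finset ℕ → α → ℕ → α) (E : Finset ℕ) : α :=
  if h : E.Nonempty then
    step (E.erase (E.max' h)) (seqRec a step (E.erase (E.max' h))) (E.max' h)
  else a
termination_by E.card
decreasing_by exact Finset.card_erase_lt_of_mem (E.max'_mem h)

lemma seqRec_empty {α : Type*} (a : α) (step : Finset ℕ → α → ℕ → α) :
    seqRec a step ∅ = a := by
  rw [seqRec, dif_neg (by simp)]

lemma seqRec_insert {α : Type*} (a : α) (step : Finset ℕ → α → ℕ → α) {E : Finset ℕ} {n : ℕ}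
    (h : Below E {n}) : seqRec a step (insert n E) = step E (seqRec a step E) n := by
  have hmax : (insert n E).max' (Finset.insert_nonempty n E) = n := by
    refine le_antisymm (Finset.max'_le _ _ _ fun y hy => ?_)
      (Finset.le_max' _ _ (Finset.mem_insert_self n E))
    rcases Finset.mem_insert.1 hy with rfl | hy
    · rfl
    · exact (below_singleton.1 h y hy).le
  rw [seqRec, dif_pos (Finset.insert_nonempty n E), hmax, Finset.erase_insert h.notMem]

/-- The `n`-th child asks for rank `r n`, and frequency allows the successors `k n` to be picked
strictly increasing. The rank conditions are premises inside the conclusion, so that the choices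
become total functions usable in a recursion. -/
lemma exists_successors (C : Finset ℕ → Set (Finset ℕ)) (s : Finset ℕ × Set (Finset ℕ))
    (b : Ordinal.{0}) (r : ℕ → Ordinal.{0}) :
    ∃ (k : ℕ → ℕ) (d : ℕ → Finset ℕ), StrictMono k ∧ ∀ n, MonoTree C s.2 s.1 b → r n < b →
      Below s.1 {k n} ∧ Init (insert (k n) s.1) (d n) ∧ MonoTree C (s.2 ∩ C (d n)) (d n) (r n) := by
  have hfreq : ∀ n, ∃ᶠ k in Filter.atTop, MonoTree C s.2 s.1 b → r n < b →
      HasNode C s.2 s.1 (r n) k := fun n => by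
    by_cases h : MonoTree C s.2 s.1 b ∧ r n < b
    · exact ((monoTree_iff.1 h.1).2 _ h.2).mono fun k hk _ _ => hk
    · exact (Filter.Eventually.of_forall fun k h1 h2 => absurd ⟨h1, h2⟩ h).frequently
  obtain ⟨k, hk, hkn⟩ := Filter.extraction_forall_of_frequently hfreq
  have hd : ∀ n, ∃ d, MonoTree C s.2 s.1 b → r n < b → Below s.1 {k n} ∧
      Init (insert (k n) s.1) d ∧ MonoTree C (s.2 ∩ C d) d (r n) := fun n => by
    by_cases h : MonoTree C s.2 s.1 b ∧ r n < b
    · obtain ⟨h1, c, h2⟩ := hkn n h.1 h.2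
      exact ⟨c, fun _ _ => ⟨h1, h2⟩⟩
    · exact ⟨∅, fun h1 h2 => absurd ⟨h1, h2⟩ h⟩
  choose d hd using hd
  exact ⟨k, d, hk, hd⟩

section
variable {G F : Set (Finset ℕ)} {C : Finset ℕ → Set (Finset ℕ)} {ρ : Finset ℕ → Ordinal.{0}}

/-- The nodes `c E` and the sets `L E` of end points with which a tree of rank at most `ρ ∅` is
embedded into a monochromatic tree. -/
lemma exists_nodes (hG : IsHereditary G) (hρ : IsRank G ρ) {L₀ : Set (Finset ℕ)}
    (hT : MonoTree C L₀ ∅ (ρ ∅)) :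
    ∃ (c : Finset ℕ → Finset ℕ) (L : Finset ℕ → Set (Finset ℕ)) (k : Finset ℕ → ℕ → ℕ),
      L ∅ = L₀ ∧ (∀ E ∈ G, MonoTree C (L E) (c E) (ρ E)) ∧ (∀ D, StrictMono (k D)) ∧
      ∀ D n, Below D {n} → insert n D ∈ G →
        Below (c D) {k D n} ∧ Init (insert (k D n) (c D)) (c (insert n D)) ∧
        L (insert n D) = L D ∩ C (c (insert n D)) := by
  choose k d hk hd using exists_successors C
  -- The state at `D` is the current node with its surviving end points; each child of `D` asks for
  -- its own rank under `ρ`.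
  let st : Finset ℕ → Finset ℕ × Set (Finset ℕ) := seqRec (∅, L₀) fun D s n =>
    (d s (ρ D) (fun m => ρ (insert m D)) n, s.2 ∩ C (d s (ρ D) (fun m => ρ (insert m D)) n))
  have hst : ∀ {D n}, Below D {n} → st (insert n D) =
      (d (st D) (ρ D) (fun m => ρ (insert m D)) n,
        (st D).2 ∩ C (d (st D) (ρ D) (fun m => ρ (insert m D)) n)) :=
    fun h => seqRec_insert _ _ h
  have hst0 : st ∅ = (∅, L₀) := seqRec_empty _ _
  have hrank : ∀ {D n}, Below D {n} → insert n D ∈ G → D ∈ G ∧ ρ (insert n D) < ρ D :=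
    fun h hmem => ⟨hG.mem_of_init hmem h.init_insert,
      hρ _ (hG.mem_of_init hmem h.init_insert) _ hmem h.pInit_insert⟩
  have htree : ∀ E ∈ G, MonoTree C (st E).2 (st E).1 (ρ E) := by
    intro E
    induction E using Finset.induction_on_max with
    | empty => intro _; rwa [hst0]
    | insert n D hD ih =>
      intro hmem
      have hn := below_singleton.2 hD
      obtain ⟨hDG, hlt⟩ := hrank hn hmem
      rw [hst hn]
      exact (hd (st D) (ρ D) (fun m => ρ (insert m D)) n (ih hDG) hlt).2.2
  refine ⟨fun E => (st E).1, fun E => (st E).2, fun D => k (st D) (ρ D) fun m => ρ (insert m D),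
    by simp [hst0], htree, fun D => hk _ _ _, fun D n hn hmem => ?_⟩
  obtain ⟨hDG, hlt⟩ := hrank hn hmem
  have := hd (st D) (ρ D) (fun m => ρ (insert m D)) n (htree D hDG) hlt
  simp only [hst hn]
  exact ⟨this.1, this.2.1, trivial⟩

/-- Nodes serve as `i`, and `e E` is any end point in `L E` above the node of `E`. Since `L E`
shrinks along initial segments, that end point has the color at every earlier non-root node. -/
theorem exists_isExtendedEmbedding (hG : IsHereditary G) (hρ : IsRank G ρ) (hF : IsHereditary F)
    (hT : MonoTree C (MAX F) ∅ (ρ ∅)) :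
    ∃ i e, IsExtendedEmbedding G F i e ∧
      ∀ H ∈ MAX G, ∀ E, E ≠ ∅ → Init E H → e H ∈ C (i E) := by
  obtain ⟨c, L, k, hL0, htree, hk, hstep⟩ := exists_nodes hG hρ hT
  have hpstep : ∀ D n, Below D {n} → insert n D ∈ G → PInit (c D) (c (insert n D)) :=
    fun D n hn hmem => by
      obtain ⟨h1, h2, -⟩ := hstep D n hn hmem
      refine ⟨h1.init_insert.trans h2, fun he => h1.notMem ?_⟩
      rw [he]
      exact h2.1 (Finset.mem_insert_self _ _)
  have hmono : ∀ E ∈ G, ∀ D, Init D E → Init (c D) (c E) ∧ L E ⊆ L D ∧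
      (D ≠ E → PInit (c D) (c E)) := by
    intro E
    induction E using Finset.induction_on_max with
    | empty =>
      intro _ D hD
      obtain rfl := hD.antisymm (init_empty D)
      exact ⟨.refl _, subset_rfl, fun h => absurd rfl h⟩
    | insert n E hE ih =>
      intro hmem D hD
      have hn := below_singleton.2 hE
      rcases hD.eq_or_of_insert hn with rfl | hD
      · exact ⟨.refl _, subset_rfl, fun h => absurd rfl h⟩
      · obtain ⟨h1, h2, -⟩ := ih (hG.mem_of_init hmem hn.init_insert) D hD
        have h3 := h1.trans_pInit (hpstep E n hn hmem)
        refine ⟨h3.1, ?_, fun _ => h3⟩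
        rw [(hstep E n hn hmem).2.2]
        exact Set.inter_subset_left.trans h2
  -- If `E` and `H` split at `D`, injectivity of `k D` sends the two branches through different
  -- successors of `c D`, so their nodes cannot be comparable.
  have hreflect : ∀ E ∈ G, ∀ H ∈ G, Init (c E) (c H) → Init E H := by
    intro E hE H hH hEH
    rcases init_or_init_or_split E H with h | h | ⟨D, m, n, hmn, hm, hn, hmE, hnH⟩
    · exact h
    · by_cases hne : H = E
      · exact hne ▸ .refl _
      · have hp := (hmono E hE H h).2.2 hne
        exact absurd (hp.1.antisymm hEH) hp.2
    · have hmG := hG.mem_of_init hE hmE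
      have hnG := hG.mem_of_init hH hnH
      obtain ⟨h1, h2, -⟩ := hstep D m hm hmG
      obtain ⟨h3, h4, -⟩ := hstep D n hn hnG
      exact absurd ((hk D).injective (Init.insert_unique h1 h3
        (h2.trans ((hmono E hE _ hmE).1.trans hEH)) (h4.trans (hmono H hH _ hnH).1))) hmn
  have hins : ∀ E ∈ G, E ≠ ∅ → c E ≠ ∅ ∧ L E ⊆ C (c E) := by
    intro E
    induction E using Finset.induction_on_max with
    | empty => intro _ h; exact absurd rfl h
    | insert n D hD ih =>
      intro hmem _
      obtain ⟨-, h2, h3⟩ := hstep D n (below_singleton.2 hD) hmem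
      refine ⟨Finset.ne_empty_of_mem (h2.1 (Finset.mem_insert_self _ _)), ?_⟩
      rw [h3]
      exact Set.inter_subset_right
  have hleaf : ∀ E, ∃ H, E ∈ G → H ∈ L E ∧ Init (c E) H := fun E => by
    by_cases hE : E ∈ G
    · obtain ⟨⟨H, hH⟩, -⟩ := monoTree_iff.1 (htree E hE)
      exact ⟨H, fun _ => hH⟩
    · exact ⟨∅, fun h => absurd h hE⟩
  choose e he using hleaf
  have heMAX : ∀ E ∈ G, e E ∈ MAX F := fun E hE =>
    hL0 ▸ (hmono E hE ∅ (init_empty E)).2.1 (he E hE).1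
  refine ⟨c, e, ⟨fun E hE => ⟨?_, ?_⟩, ?_, ?_, fun E hE => heMAX E hE.1,
    fun E hE _ => (he E hE.1).2⟩, fun H hH E hE hEH => ?_⟩
  · exact hF.mem_of_init (heMAX E hE.1).1 (he E hE.1).2
  · exact (hins E hE.1 hE.2).1
  · intro E hE H hH hEH
    exact (hreflect E hE.1 H hH.1 (hEH ▸ .refl _)).antisymm
      (hreflect H hH.1 E hE.1 (hEH ▸ .refl _))
  · intro E hE H hH
    refine ⟨fun h => (hmono H hH.1 E h.1).2.2 h.2, fun h => ?_⟩
    exact ⟨hreflect E hE.1 H hH.1 h.1, fun heq => h.2 (congrArg c heq)⟩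
  · exact (hins E (hG.mem_of_init hH.1 hEH) hE).2 ((hmono H hH.1 E hEH).2.1 (he H hH.1).1)

end

end RegularFamily

theorem lemma4p1
    (𝓢 : Ordinal.{0} → Set (Finset ℕ)) (h𝓢 : RegularFamily.IsFineSchreier 𝓢)
    (F : Set (Finset ℕ)) (hF : RegularFamily.IsRegular F) (hpos : 0 < RegularFamily.iota F)
    (A : Fin 2 → Finset ℕ → Set (Finset ℕ)) (hA : RegularFamily.IsColoring F A) :
    ∃ ξ : Fin 2 → Ordinal.{0},
      (∀ j, ξ j < ω₁ ∧ ∃ i e : Finset ℕ → Finset ℕ,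
        RegularFamily.IsExtendedEmbedding (𝓢 (ξ j)) F i e ∧
        RegularFamily.IsMonochromatic (𝓢 (ξ j))
          (RegularFamily.inducedColoring (𝓢 (ξ j)) A i e) j) ∧
      RegularFamily.hessenberg (ξ 0) (ξ 1) = RegularFamily.iota F := by
  open RegularFamily in
  have hcover : ∀ c, c ≠ ∅ → ∀ H ∈ MAX F, Init c H → H ∈ A 0 c ∪ A 1 c := fun c hc H hH hcH => by
    rw [hA c ⟨hF.hereditary.mem_of_init hH.1 hcH, hc⟩]
    exact ⟨hH, hcH⟩
  obtain ⟨x, y, hle, hx, hy⟩ := (hF.monoTree_iota hpos).exists_le_hessenberg hcover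
  -- Trees persist when their rank is lowered, so exact equality with `iota F` costs nothing; it
  -- also bounds both indices by `iota F`, hence by `ω₁`.
  obtain ⟨x', hx', y', hy', heq⟩ := exists_hessenberg_eq hle
  have hι := (iota_spec hpos).1
  have hemb : ∀ j ξ, ξ < ω₁ → MonoTree (A j) (MAX F) ∅ ξ → ξ < ω₁ ∧
      ∃ i e : Finset ℕ → Finset ℕ, IsExtendedEmbedding (𝓢 ξ) F i e ∧
        IsMonochromatic (𝓢 ξ) (inducedColoring (𝓢 ξ) A i e) j := fun j ξ hξ hT => by
    obtain ⟨hher, -, ρ, hρ, hρ0⟩ := h𝓢.hereditary_and_exists_rank hξ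
    obtain ⟨i, e, hie, hmono⟩ :=
      exists_isExtendedEmbedding hher hρ hF.hereditary (hT.of_le hρ0)
    exact ⟨hξ, i, e, hie, fun H hH E hE hEH => ⟨hH, hmono H hH E hE hEH⟩⟩
  refine ⟨![x', y'], fun j => ?_, heq⟩
  fin_cases j
  · exact hemb 0 x' (((le_hessenberg_left x' y').trans heq.le).trans_lt hι) (hx.of_le hx')
  · exact hemb 1 y' (((le_hessenberg_right x' y').trans heq.le).trans_lt hι) (hy.of_le hy')
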